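/- Let $F_1\in\mathbb{C}^{n\times n}$ and $F_2\in\mathbb{C}^{n\times n^2}$ (in particular real matrices), and let $F_1=W\Lambda W^{-1}$ with $W$ invertible and $\Lambda=\mathrm{diag}(\lambda_1,\dots,\lambda_n)$. For $N\ge 0$ let $\mathbf{A}$ be the truncated Carleman matrix of $\dot x=F_1x+F_2\,x\otimes x$: the block matrix with blocks indexed by $1\le j\le N$ (the $j$-th of size $n^j$), diagonal blocks $A_{j,j}=\sum_{i=0}^{j-1}I^{\otimes i}\otimes F_1\otimes I^{\otimes(j-1-i)}$, superdiagonal blocks $A_{j,j+1}=\sum_{i=0}^{j-1}I^{\otimes i}\otimes F_2\otimes I^{\otimes(j-1-i)}$, and all other blocks zero. Let $\|\cdot\|_1$ be the matrix norm induced by the $\ell^1$ vector norm, $\kappa_1(W)=\|W\|_1\|W^{-1}\|_1$, and let $\widehat W$ be $W$ with its columns scaled to unit $\ell^1$ norm (so $\widehat W=W$ if the eigenvectors are normalized). Assume the no-resonance condition: $\lambda_i\neq\sum_{j}m_j\lambda_j$ for all $i$ and all integers $m_j\ge0$ with $\sum_j m_j\ge2$. Put $$\Delta=\inf_{k}\ \inf_{m_j\ge0,\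 \sum_j m_j\ge2}\Big|\lambda_k-\sum_{j}m_j\lambda_j\Big| .$$ Let $D$ be the block diagonal matrix whose $j$-th block is the Kronecker sum $\sum_{i=0}^{j-1}I^{\otimes i}\otimes\Lambda\otimes I^{\otimes(j-1-i)}$. Then $D$ is diagonal and $\mathbf{A}$ is diagonalizable: there is an invertible matrix $V$ with $\mathbf{A}V=VD$, and $V$ is block upper triangular with diagonal blocks $V_{k,k}=\widehat W^{\otimes k}$. Moreover, in the eigenbasis of $F_1$ the diagonal blocks are identities: $V=\mathrm{diag}(\widehat W,\widehat W^{\otimes2},\dots,\widehat W^{\otimes N})\,V^{0}$, where $V^{0}$ is block upper triangular, $V^{0}_{k,k}=I$ for all $k$, and $\mathbf{A}^{0}V^{0}=V^{0}D$ for the truncated Carleman matrix $\mathbf{A}^{0}$ of the transformed coefficients $\Lambda$ and $\widehat W^{-1}F_2(\widehat W\otimes\widehat W)$. If $\Delta>0$, then for $M=V$ and for $M=V^{0}$, and all $1\le k\le j\le N$, $$\|M_{k,j}\|_1\le\Big(\frac{\kappa_1(W)\|F_2\|_1}{\Delta}\Big)^{j-k}\binom{2j-k}{j-k};$$ consequently,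 for $k<j$, $$\|M_{k,j}\|_1\le\Big(e\,\frac{2j-k}{j-k}\cdot\frac{\kappa_1(W)\|F_2\|_1}{\Delta}\Big)^{j-k};$$ and for $k\le 5$ and $k\le j$, $$\|M_{k,j}\|_1\le\Big(\frac{2e\,\kappa_1(W)\|F_2\|_1}{\Delta}\Big)^{j-k}.$$ -/

import Mathlib

open scoped Kronecker

namespace Carleman

/-! Tensors of order `j` on an `n`-dimensional space are indexed by tuples `Fin j → Fin n`. -/

/-- The `k`-fold Kronecker power `M ⊗ ⋯ ⊗ M`. -/
def kronPow {R : Type*} [CommRing R] {n : ℕ} (M : Matrix (Fin n) (Fin n) R) (k : ℕ) :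
    Matrix (Fin k → Fin n) (Fin k → Fin n) R :=
  Matrix.of fun a b => ∏ l, M (a l) (b l)

/-- The Kronecker sum `∑ i, I ^ ⊗ i ⊗ M ⊗ I ^ ⊗ (j - 1 - i)`, where `i` runs over `0, …, j - 1`. -/
def kronSum {R : Type*} [CommRing R] {n : ℕ} (M : Matrix (Fin n) (Fin n) R) (j : ℕ) :
    Matrix (Fin j → Fin n) (Fin j → Fin n) R :=
  Matrix.of fun a b => ∑ i : Fin j,
    (∏ l with l < i, (1 : Matrix (Fin n) (Fin n) R) (a l) (b l)) * M (a i) (b i) *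
      ∏ l with i < l, (1 : Matrix (Fin n) (Fin n) R) (a l) (b l)

/-- The matrix `∑ i, I ^ ⊗ i ⊗ F ⊗ I ^ ⊗ (j - 1 - i)`, where `i` runs over `0, …, j - 1` and `F`
sends tensors of order two to vectors. -/
def kronShift {R : Type*} [CommRing R] {n : ℕ} (F : Matrix (Fin n) (Fin n × Fin n) R) (j : ℕ) :
    Matrix (Fin j → Fin n) (Fin (j + 1) → Fin n) R :=
  Matrix.of fun a b => ∑ i : Fin j,
    (∏ l with l < i, (1 : Matrix (Fin n) (Fin n) R) (a l) (b l.castSucc)) *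
      F (a i) (b i.castSucc, b i.succ) *
      ∏ l with i < l, (1 : Matrix (Fin n) (Fin n) R) (a l) (b l.succ)

/-- Index set of the truncated system at level `N`: the block `k : Fin N` holds the tensors of
order `k + 1`. -/
abbrev Index (n N : ℕ) : Type := Σ k : Fin N, (Fin (k.val + 1) → Fin n)

/-- The truncated Carleman matrix: block bidiagonal, with `kronSum F₁ j` on the diagonal and
`kronShift F₂ j` next to it. -/
def carleman {R : Type*} [CommRing R] {n : ℕ} (F₁ : Matrix (Fin n) (Fin n) R)
    (F₂ : Matrix (Fin n) (Fin n × Fin n) R) (N : ℕ) : Matrix (Index n N) (Index n N) R :=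
  Matrix.of fun p q =>
    if h : p.1.val + 1 = q.1.val + 1 then
      kronSum F₁ (p.1.val + 1) p.2 (q.2 ∘ Fin.cast h)
    else if h : p.1.val + 1 + 1 = q.1.val + 1 then
      kronShift F₂ (p.1.val + 1) p.2 (q.2 ∘ Fin.cast h)
    else 0

/-- The block diagonal matrix of the Kronecker sums of `Λ = diag lam`. -/
def eigenvalueMatrix {R : Type*} [CommRing R] {n : ℕ} (lam : Fin n → R) (N : ℕ) :
    Matrix (Index n N) (Index n N) R :=
  Matrix.blockDiagonal' fun k : Fin N => kronSum (Matrix.diagonal lam) (k.val + 1)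

/-- The block diagonal matrix of the Kronecker powers of `M`. -/
def blockPow {R : Type*} [CommRing R] {n : ℕ} (M : Matrix (Fin n) (Fin n) R) (N : ℕ) :
    Matrix (Index n N) (Index n N) R :=
  Matrix.blockDiagonal' fun k : Fin N => kronPow M (k.val + 1)

/-- The block in block row `k` and block column `j`. -/
def block {R : Type*} {n N : ℕ} (V : Matrix (Index n N) (Index n N) R) (k j : Fin N) :
    Matrix (Fin (k.val + 1) → Fin n) (Fin (j.val + 1) → Fin n) R :=
  Matrix.of fun a b => V ⟨k, a⟩ ⟨j, b⟩

/-- The matrix norm induced by the `ℓ¹` vector norms. -/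
noncomputable def oneNorm {ι κ : Type*} [Fintype ι] [Fintype κ] [DecidableEq κ]
    (M : Matrix ι κ ℂ) : ℝ :=
  ‖(Matrix.toLpLin 1 1 M).toContinuousLinearMap‖

/-- The condition number in the `ℓ¹` norm. -/
noncomputable def cond {n : ℕ} (W : Matrix (Fin n) (Fin n) ℂ) : ℝ :=
  oneNorm W * oneNorm W⁻¹

/-- The matrix `W` with its columns scaled to unit `ℓ¹` norm. -/
noncomputable def normalizeColumns {n : ℕ} (W : Matrix (Fin n) (Fin n) ℂ) :
    Matrix (Fin n) (Fin n) ℂ :=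
  Matrix.of fun i j => W i j / ((∑ l, ‖W l j‖ : ℝ) : ℂ)

/-- No eigenvalue is a combination of the eigenvalues with nonnegative integer coefficients whose
sum is at least two. -/
def NoResonance {n : ℕ} (lam : Fin n → ℂ) : Prop :=
  ∀ (i : Fin n) (m : Fin n → ℕ), 2 ≤ ∑ j, m j → lam i ≠ ∑ j, (m j : ℂ) * lam j

/-- The resonance parameter `Δ`. -/
noncomputable def resonanceParam {n : ℕ} (lam : Fin n → ℂ) : ℝ :=
  ⨅ k : Fin n, ⨅ m : {m : Fin n → ℕ // 2 ≤ ∑ j, m j}, ‖lam k - ∑ j, (m.1 j : ℂ) * lam j‖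

end Carleman

/-! In eigencoordinates the system is `y' = Λ y + G (y ⊗ y)`. Without resonance it has a formal
linearization `y = φ(z)`, tangent to the identity, with `z' = Λ z`. Differentiating `φ^{⊗k}` along
`z' = Λ z` gives the `k`-th Carleman row. Hence the degree-`j` coefficients of `φ^{⊗k}` form the
block `(k, j)` of an eigenvector matrix `V₀`. Coefficients are indexed by words (noncommuting
variables), matching the tensor indices, and products become the convolution `conv`. The recursion
`taylor` divides by `∑ λ_{b i} - λ_a`, and `sum_mul_tensorTaylor` is the eigenvector equation. The
general case follows by conjugating with the Kronecker powers of the normalized eigenvector matrix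
(`carleman_mul_blockPow`).

For the bounds, put `r = f / Δ`, with `f` bounding the norm of `G`. The column sums of the
degree-`j` coefficients of `φ` are at most those of the solution of `y = X + r y ^ 2`, a rescaled
Catalan series. The powers of that series have coefficients `r ^ (j - k) * ballot k (j - k)`, so
everything reduces to estimates of ballot numbers. Normalized columns give `‖P^{⊗k}‖₁ ≤ 1`, so
returning from `V₀` to `V` costs nothing, while `f = κ₁(W) ‖F₂‖₁` is admissible for the transformed
coefficient. -/

namespace Carleman


/-! ### Ballot numbers and powers of the Catalan series. -/

section Ballot

open PowerSeries

/-- The ballot numbers `k / (2 m + k) * (2 m + k).choose m`, the coefficients of the `k`-th power of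
the generating function of the Catalan numbers. -/
def ballot : ℕ → ℕ → ℕ
  | _, 0 => 1
  | 0, _ + 1 => 0
  | k + 1, m + 1 => ballot k (m + 1) + ballot (k + 2) m
termination_by k m => (m, k)

@[simp] theorem ballot_zero_right (k : ℕ) : ballot k 0 = 1 := by
  cases k <;> simp [ballot]

@[simp] theorem ballot_zero_succ (m : ℕ) : ballot 0 (m + 1) = 0 := by
  simp [ballot]

theorem ballot_succ_succ (k m : ℕ) :
    ballot (k + 1) (m + 1) = ballot k (m + 1) + ballot (k + 2) m := by
  rw [ballot]

/-- By Pascal's rule the binomials obey the same recursion as `ballot`; only their boundary values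
at `k = 0` are larger. -/
theorem ballot_le_choose (k m : ℕ) : ballot k m ≤ (2 * m + k).choose m := by
  induction m generalizing k with
  | zero => simp
  | succ m ihm =>
    induction k with
    | zero => simp
    | succ k ihk =>
      have h := ihm (k + 2)
      rw [ballot_succ_succ, show 2 * (m + 1) + (k + 1) = (2 * m + (k + 2)) + 1 by ring,
        Nat.choose_succ_succ]
      rw [show 2 * (m + 1) + k = 2 * m + (k + 2) by ring] at ihk
      lia

theorem ballot_mono_left (m : ℕ) : Monotone fun k => ballot k m := by
  refine monotone_nat_of_le_succ fun k => ?_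
  cases m with
  | zero => simp
  | succ m => simp [ballot_succ_succ]

open Nat in
-- Division-free closed form, needed for the ratio of consecutive terms in `ballot_five_succ`.
theorem ballot_mul_factorial (k m : ℕ) :
    ballot (k + 1) m * (m ! * (m + k + 1)!) = (k + 1) * (2 * m + k)! := by
  induction m generalizing k with
  | zero => simp [Nat.factorial_succ]
  | succ m ihm =>
    induction k with
    | zero =>
      have h := ihm 1
      rw [ballot_succ_succ, ballot_zero_succ]
      simp only [Nat.factorial_succ, show 2 * (m + 1) + 0 = 2 * m + 1 + 1 by ring,
        show m + 1 + 0 + 1 = m + 1 + 1 by ring] at h ⊢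
      linear_combination (m + 1) * h
    | succ k ihk =>
      have h := ihm (k + 2)
      rw [ballot_succ_succ]
      simp only [Nat.factorial_succ, show 2 * (m + 1) + k = 2 * m + k + 1 + 1 by ring,
        show 2 * (m + 1) + (k + 1) = 2 * m + k + 1 + 1 + 1 by ring,
        show 2 * m + (k + 2) = 2 * m + k + 1 + 1 by ring,
        show m + 1 + k + 1 = m + k + 1 + 1 by ring,
        show m + 1 + (k + 1) + 1 = m + k + 1 + 1 + 1 by ring,
        show m + (k + 2) + 1 = m + k + 1 + 1 + 1 by ring,
        show k + 2 + 1 = k + 1 + 2 by ring] at h ihk ⊢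
      -- The multipliers complete `m !` to `(m + 1)!` and `(m + k + 2)!` to `(m + k + 3)!`.
      linear_combination (m + 1) * h + (m + k + 3) * ihk

open Nat in
theorem ballot_five_succ (m : ℕ) :
    ballot 5 (m + 1) * ((m + 1) * (m + 6)) = (2 * m + 6) * (2 * m + 5) * ballot 5 m := by
  have h0 := ballot_mul_factorial 4 m
  have h1 := ballot_mul_factorial 4 (m + 1)
  have hpos : 0 < m ! * (m + 5)! := by positivity
  refine Nat.eq_of_mul_eq_mul_right hpos ?_
  simp only [show 4 + 1 = 5 from rfl, show m + 4 + 1 = m + 5 from rfl,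
    show 2 * (m + 1) + 4 = 2 * m + 4 + 1 + 1 by ring,
    Nat.factorial_succ m, Nat.factorial_succ (m + 5), Nat.factorial_succ (2 * m + 4),
    Nat.factorial_succ (2 * m + 4 + 1)] at h0 h1
  linear_combination h1 - (2 * m + 6) * (2 * m + 5) * h0

/-- The ratio of consecutive terms is `(2m+6)(2m+5) / ((m+1)(m+6)) ≤ 5`, with equality at `m = 0`.
Five is the last order covered by base `2e`: `ballot 6 1 = 6 > 2e`. -/
theorem ballot_five_le (m : ℕ) : ballot 5 m ≤ 5 ^ m := by
  induction m with
  | zero => simp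
  | succ m ih =>
    have h := ballot_five_succ m
    have hpos : 0 < (m + 1) * (m + 6) := by positivity
    refine Nat.le_of_mul_le_mul_right (c := (m + 1) * (m + 6)) ?_ hpos
    calc ballot 5 (m + 1) * ((m + 1) * (m + 6)) = (2 * m + 6) * (2 * m + 5) * ballot 5 m := h
      _ ≤ (5 * ((m + 1) * (m + 6))) * 5 ^ m := Nat.mul_le_mul (by nlinarith) ih
      _ = 5 ^ (m + 1) * ((m + 1) * (m + 6)) := by ring

/-- The power series `y` with `y = X + r * y ^ 2` and constant coefficient `0`. -/
noncomputable def majorant (r : ℝ) : ℝ⟦X⟧ :=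
  X * PowerSeries.mk fun i => r ^ i * (catalan i : ℝ)

/-- This is Segner's recursion for the Catalan numbers, rescaled by `r`. -/
theorem majorant_eq (r : ℝ) : majorant r = X + C r * majorant r ^ 2 := by
  have key : (PowerSeries.mk fun i => r ^ i * (catalan i : ℝ)) =
      1 + C r * X * (PowerSeries.mk fun i => r ^ i * (catalan i : ℝ)) ^ 2 := by
    ext i
    cases i with
    | zero => simp
    | succ i =>
      rw [map_add, mul_assoc, coeff_C_mul, coeff_succ_X_mul, pow_two, coeff_mul]
      simp only [coeff_mk, coeff_one, catalan_succ', Nat.cast_sum, Finset.mul_sum]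
      simp only [Nat.add_eq_zero_iff, one_ne_zero, and_false, if_false, zero_add]
      refine Finset.sum_congr rfl fun x hx => ?_
      rw [← Finset.HasAntidiagonal.mem_antidiagonal.1 hx]
      push_cast
      ring
  unfold majorant
  linear_combination X * key

/-- Multiplying `y = X + r y ^ 2` by `y ^ k` gives the recursion that defines `ballot`. -/
theorem coeff_majorant_pow_succ (r : ℝ) (k j : ℕ) :
    coeff (j + 1) (majorant r ^ (k + 1)) =
      coeff j (majorant r ^ k) + r * coeff (j + 1) (majorant r ^ (k + 2)) := by
  have h : majorant r ^ (k + 1) = X * majorant r ^ k + C r * majorant r ^ (k + 2) := by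
    linear_combination majorant r ^ k * majorant_eq r
  rw [h, map_add, coeff_succ_X_mul, coeff_C_mul]

theorem coeff_majorant_pow_of_lt (r : ℝ) {k j : ℕ} (h : j < k) :
    coeff j (majorant r ^ k) = 0 := by
  rw [majorant, mul_pow, coeff_X_pow_mul', if_neg (by lia)]

theorem coeff_majorant_pow (r : ℝ) (k m : ℕ) :
    coeff (k + m) (majorant r ^ k) = r ^ m * ballot k m := by
  induction m generalizing k with
  | zero =>
    induction k with
    | zero => simp
    | succ k ih =>
      rw [add_zero, coeff_majorant_pow_succ, coeff_majorant_pow_of_lt r (by lia : k + 1 < k + 2)]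
      simpa using ih
  | succ m ihm =>
    induction k with
    | zero => simp [coeff_one]
    | succ k ihk =>
      have h := ihm (k + 2)
      rw [show k + 1 + (m + 1) = k + (m + 1) + 1 by ring, coeff_majorant_pow_succ, ihk,
        show k + (m + 1) + 1 = k + 2 + m by ring, h, ballot_succ_succ]
      push_cast
      ring

theorem coeff_majorant_pow_of_le (r : ℝ) {k j : ℕ} (h : k ≤ j) :
    coeff j (majorant r ^ k) = r ^ (j - k) * ballot k (j - k) := by
  obtain ⟨m, rfl⟩ := Nat.exists_eq_add_of_le h
  rw [coeff_majorant_pow, Nat.add_sub_cancel_left]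

theorem coeff_majorant_pow_nonneg {r : ℝ} (hr : 0 ≤ r) (k j : ℕ) :
    0 ≤ coeff j (majorant r ^ k) := by
  rcases lt_or_ge j k with h | h
  · rw [coeff_majorant_pow_of_lt r h]
  · rw [coeff_majorant_pow_of_le r h]
    positivity

end Ballot

/-! ### Convolution of functions on words. -/

section Convolution

variable {ι : Type*}

/-- The convolution of two functions on words: the sum over all ways to cut the word in two. -/
def conv (f g : List ι → ℂ) (b : List ι) : ℂ :=
  ∑ i ∈ Finset.range (b.length + 1), f (b.take i) * g (b.drop i)

@[simp] theorem conv_nil (f g : List ι → ℂ) : conv f g [] = f [] * g [] := by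
  simp [conv]

theorem conv_cons (f g : List ι → ℂ) (x : ι) (b : List ι) :
    conv f g (x :: b) = f [] * g (x :: b) + conv (fun l => f (x :: l)) g b := by
  simp only [conv, List.length_cons]
  rw [Finset.sum_range_succ', add_comm]
  simp

theorem conv_add_left (f₁ f₂ g : List ι → ℂ) (b : List ι) :
    conv (fun l => f₁ l + f₂ l) g b = conv f₁ g b + conv f₂ g b := by
  simp [conv, add_mul, Finset.sum_add_distrib]

theorem conv_add_right (f g₁ g₂ : List ι → ℂ) (b : List ι) :
    conv f (fun l => g₁ l + g₂ l) b = conv f g₁ b + conv f g₂ b := by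
  simp [conv, mul_add, Finset.sum_add_distrib]

theorem conv_const_mul_left (c : ℂ) (f g : List ι → ℂ) (b : List ι) :
    conv (fun l => c * f l) g b = c * conv f g b := by
  simp [conv, mul_assoc, Finset.mul_sum]

theorem conv_const_mul_right (c : ℂ) (f g : List ι → ℂ) (b : List ι) :
    conv f (fun l => c * g l) b = c * conv f g b := by
  simp [conv, mul_left_comm, Finset.mul_sum]

theorem conv_sum_left {κ : Type*} (s : Finset κ) (f : κ → List ι → ℂ) (g : List ι → ℂ)
    (b : List ι) : conv (fun l => ∑ c ∈ s, f c l) g b = ∑ c ∈ s, conv (f c) g b := by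
  simp only [conv, Finset.sum_mul]
  exact Finset.sum_comm

theorem conv_sum_right {κ : Type*} (s : Finset κ) (f : List ι → ℂ) (g : κ → List ι → ℂ)
    (b : List ι) : conv f (fun l => ∑ c ∈ s, g c l) b = ∑ c ∈ s, conv f (g c) b := by
  simp only [conv, Finset.mul_sum]
  exact Finset.sum_comm

theorem conv_assoc (f g h : List ι → ℂ) (b : List ι) :
    conv (conv f g) h b = conv f (conv g h) b := by
  induction b generalizing f with
  | nil => simp [mul_assoc]
  | cons x b ih =>
    rw [conv_cons, conv_cons f, conv_cons g]
    simp only [conv_nil, conv_cons f g]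
    rw [conv_add_left, conv_const_mul_left, ih]
    ring

/-- Multiplication by an additive weight is a derivation for the convolution. -/
theorem sum_map_mul_conv (lam : ι → ℂ) (f g : List ι → ℂ) (b : List ι) :
    (b.map lam).sum * conv f g b =
      conv (fun l => (l.map lam).sum * f l) g b + conv f (fun l => (l.map lam).sum * g l) b := by
  simp only [conv, Finset.mul_sum, ← Finset.sum_add_distrib]
  refine Finset.sum_congr rfl fun i _ => ?_
  nth_rw 1 [← List.take_append_drop i b]
  rw [List.map_append, List.sum_append]
  ring

/-- Without constant terms only cuts into two nonempty words count; this makes the recursion for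
`taylor` well-founded. -/
theorem conv_eq_sum_fin {f g : List ι → ℂ} (hf : f [] = 0) (hg : g [] = 0) {b : List ι}
    (hb : 1 ≤ b.length) :
    conv f g b = ∑ i : Fin (b.length - 1), f (b.take (i.val + 1)) * g (b.drop (i.val + 1)) := by
  rw [conv, Finset.sum_range_succ', ← Nat.sub_add_cancel hb, Finset.sum_range_succ]
  rw [Nat.sub_add_cancel hb, Finset.sum_range]
  simp [hf, hg]

/-- The action of the quadratic part on functions of words, one letter at a time. -/
noncomputable def shiftAct [Fintype ι] (F : Matrix ι (ι × ι) ℂ) : (List ι → ℂ) → List ι → ℂ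
  | _, [] => 0
  | G, a :: l => (∑ c : ι × ι, F a c * G (c.1 :: c.2 :: l)) + shiftAct F (fun t => G (a :: t)) l

/-- The shift acts on the row word and the convolution on the column word, so they commute. -/
theorem shiftAct_conv [Fintype ι] (F : Matrix ι (ι × ι) ℂ) (f : List ι → ℂ) (G : List ι → List ι → ℂ) (l b : List ι) :
    shiftAct F (fun t => conv f (G t) b) l = conv f (fun d => shiftAct F (fun t => G t d) l) b := by
  induction l generalizing G with
  | nil => simp [shiftAct, conv]
  | cons a l ih =>
    simp only [shiftAct]
    rw [conv_add_right, conv_sum_right, ih]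
    simp only [conv_const_mul_right]

end Convolution

/-! ### The formal linearization and its tensor powers. -/

section Taylor

variable {ι : Type*} [Fintype ι] [DecidableEq ι]

/-- The Taylor coefficient at the word `b` of the `a`-th component of the linearization of the
quadratic system with linear part `diag lam` and quadratic part `F`. -/
noncomputable def taylor (lam : ι → ℂ) (F : Matrix ι (ι × ι) ℂ) (a : ι) (b : List ι) : ℂ :=
  if b.length = 0 then 0
  else if b.length = 1 then (if b = [a] then 1 else 0)
  else
    (∑ c : ι × ι, F a c * ∑ i : Fin (b.length - 1),
      taylor lam F c.1 (b.take (i.val + 1)) * taylor lam F c.2 (b.drop (i.val + 1))) /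
      ((b.map lam).sum - lam a)
termination_by b.length
decreasing_by
  · have := i.2; simp only [List.length_take]; lia
  · have := i.2; simp only [List.length_drop]; lia

variable (lam : ι → ℂ) (F : Matrix ι (ι × ι) ℂ)

@[simp] theorem taylor_nil (a : ι) : taylor lam F a [] = 0 := by
  rw [taylor]; simp

theorem taylor_singleton (a x : ι) : taylor lam F a [x] = if a = x then 1 else 0 := by
  rw [taylor]; simp [eq_comm]

theorem taylor_of_two_le (a : ι) {b : List ι} (hb : 2 ≤ b.length) :
    taylor lam F a b =
      (∑ c : ι × ι, F a c * conv (taylor lam F c.1) (taylor lam F c.2) b) /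
        ((b.map lam).sum - lam a) := by
  rw [taylor, if_neg (by lia), if_neg (by lia)]
  congr 1
  refine Finset.sum_congr rfl fun c _ => ?_
  rw [conv_eq_sum_fin (taylor_nil _ _ _) (taylor_nil _ _ _) (by lia)]

theorem conv_taylor_of_length_lt (a c : ι) {b : List ι} (hb : b.length < 2) :
    conv (taylor lam F a) (taylor lam F c) b = 0 := by
  match b, hb with
  | [], _ => simp
  | [x], _ => simp [conv_cons]

/-- The coefficients of the tensor powers of the linearization. -/
noncomputable def tensorTaylor : List ι → List ι → ℂ
  | [], b => if b = [] then 1 else 0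
  | a :: l, b => conv (taylor lam F a) (tensorTaylor l) b

theorem tensorTaylor_nil (b : List ι) : tensorTaylor lam F [] b = if b = [] then 1 else 0 := rfl

theorem tensorTaylor_cons (a : ι) (l : List ι) :
    tensorTaylor lam F (a :: l) = conv (taylor lam F a) (tensorTaylor lam F l) := rfl

/-- The linearization has no constant term, so a product of `k` of its components starts in degree
`k`. -/
theorem tensorTaylor_of_length_lt {l b : List ι} (h : b.length < l.length) :
    tensorTaylor lam F l b = 0 := by
  induction l generalizing b with
  | nil => simp at h
  | cons a l ih =>
    rw [tensorTaylor_cons, conv]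
    refine Finset.sum_eq_zero fun i _ => ?_
    cases b with
    | nil => simp
    | cons x b =>
      cases i with
      | zero => simp
      | succ i =>
        rw [ih, mul_zero]
        simp only [List.length_cons, List.length_drop] at h ⊢
        lia

theorem tensorTaylor_of_length_eq {l b : List ι} (h : b.length = l.length) :
    tensorTaylor lam F l b = if l = b then 1 else 0 := by
  induction l generalizing b with
  | nil => simp [tensorTaylor_nil, eq_comm]
  | cons a l ih =>
    cases b with
    | nil => simp at h
    | cons x b =>
      have hb : b.length = l.length := by simpa using h
      -- A longer first piece leaves too few letters for the remaining factors; an empty one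
      -- contributes zero.
      rw [tensorTaylor_cons, conv, Finset.sum_eq_single 1]
      · simp only [List.take_succ_cons, List.take_zero, List.drop_succ_cons, List.drop_zero,
          taylor_singleton, ih hb, List.cons.injEq]
        by_cases h1 : a = x <;> by_cases h2 : l = b <;> simp [h1, h2]
      · intro i _ hi
        match i, hi with
        | 0, _ => simp
        | i + 2, _ =>
          rename_i hmem
          rw [Finset.mem_range, List.length_cons] at hmem
          rw [tensorTaylor_of_length_lt, mul_zero]
          simp only [List.length_cons, List.length_drop] at h hi ⊢
          lia
      · intro hi
        simp at hi

theorem sum_mul_taylor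
    (hlam : ∀ (a : ι) (b : List ι), 2 ≤ b.length → (b.map lam).sum - lam a ≠ 0)
    (a : ι) (b : List ι) :
    (b.map lam).sum * taylor lam F a b =
      lam a * taylor lam F a b +
        ∑ c : ι × ι, F a c * conv (taylor lam F c.1) (taylor lam F c.2) b := by
  by_cases hb : 2 ≤ b.length
  · have h := hlam a b hb
    rw [taylor_of_two_le lam F a hb]
    field_simp
    ring
  · rw [Finset.sum_eq_zero fun c _ => by
      rw [conv_taylor_of_length_lt lam F _ _ (by lia), mul_zero]]
    match b, hb with
    | [], _ => simp
    | [x], _ =>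
      rw [taylor_singleton]
      by_cases h : a = x <;> simp [h]
    | x :: y :: b, hb => simp at hb

/-- Leibniz rule: the weight of `b` is a derivation for `conv`, so each factor contributes its own
equation `sum_mul_taylor`. The linear parts add up to the weight of `l`, the quadratic parts to
`shiftAct`. -/
theorem sum_mul_tensorTaylor
    (hlam : ∀ (a : ι) (b : List ι), 2 ≤ b.length → (b.map lam).sum - lam a ≠ 0)
    (l b : List ι) :
    (b.map lam).sum * tensorTaylor lam F l b =
      (l.map lam).sum * tensorTaylor lam F l b +
        shiftAct F (fun t => tensorTaylor lam F t b) l := by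
  induction l generalizing b with
  | nil =>
    rw [tensorTaylor_nil]
    by_cases h : b = [] <;> simp [h, shiftAct]
  | cons a l ih =>
    rw [tensorTaylor_cons, sum_map_mul_conv]
    simp only [sum_mul_taylor lam F hlam, ih, shiftAct, tensorTaylor_cons, List.map_cons,
      List.sum_cons]
    rw [conv_add_left, conv_add_right, conv_const_mul_left, conv_const_mul_right, conv_sum_left,
      shiftAct_conv]
    simp only [conv_const_mul_left, conv_assoc]
    ring

end Taylor


/-! ### Majorization of the column sums. -/

section Majorant

theorem sum_ofFn_succ {ι : Type*} [Fintype ι] {R : Type*} [AddCommMonoid R] {k : ℕ} (g : List ι → R) :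
    ∑ a : Fin (k + 1) → ι, g (List.ofFn a) =
      ∑ x : ι × (Fin k → ι), g (x.1 :: List.ofFn x.2) := by
  rw [← (Fin.consEquiv fun _ : Fin (k + 1) => ι).sum_comp]
  simp [Fin.consEquiv, List.ofFn_succ]

/-- The hypothesis bounds products rather than single factors: in the induction for `taylor`, an end
cut leaves a factor at `b` itself, not yet bounded, but its partner vanishes. -/
theorem sum_norm_conv_le {ι κ μ : Type*} [Fintype κ] [Fintype μ] (f : κ → List ι → ℂ)
    (g : μ → List ι → ℂ) (p q : PowerSeries ℝ) (b : List ι)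
    (h : ∀ i ≤ b.length, (∑ x, ‖f x (b.take i)‖) * (∑ y, ‖g y (b.drop i)‖) ≤
      PowerSeries.coeff i p * PowerSeries.coeff (b.length - i) q) :
    ∑ x : κ × μ, ‖conv (f x.1) (g x.2) b‖ ≤ PowerSeries.coeff b.length (p * q) := by
  rw [PowerSeries.coeff_mul, Finset.Nat.sum_antidiagonal_eq_sum_range_succ
    fun i j => PowerSeries.coeff i p * PowerSeries.coeff j q]
  calc ∑ x : κ × μ, ‖conv (f x.1) (g x.2) b‖
      ≤ ∑ x : κ × μ, ∑ i ∈ Finset.range (b.length + 1),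
          ‖f x.1 (b.take i)‖ * ‖g x.2 (b.drop i)‖ := by
        refine Finset.sum_le_sum fun x _ => (norm_sum_le _ _).trans_eq ?_
        simp only [norm_mul]
    _ = ∑ i ∈ Finset.range (b.length + 1),
          (∑ x, ‖f x (b.take i)‖) * (∑ y, ‖g y (b.drop i)‖) := by
        rw [Finset.sum_comm]
        refine Finset.sum_congr rfl fun i _ => ?_
        rw [Finset.sum_mul_sum, Fintype.sum_prod_type]
    _ ≤ _ := Finset.sum_le_sum fun i hi => h i (by simpa [Nat.lt_succ_iff] using hi)

variable {ι : Type*} [Fintype ι] [DecidableEq ι] {lam : ι → ℂ} {F : Matrix ι (ι × ι) ℂ} {f δ : ℝ}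

theorem sum_norm_taylor_le (hf : 0 ≤ f) (hδ : 0 < δ) (hF : ∀ c, ∑ a, ‖F a c‖ ≤ f)
    (hlam : ∀ (a : ι) (b : List ι), 2 ≤ b.length → δ ≤ ‖(b.map lam).sum - lam a‖)
    (b : List ι) :
    ∑ a, ‖taylor lam F a b‖ ≤ PowerSeries.coeff b.length (majorant (f / δ)) := by
  have hr : 0 ≤ f / δ := by positivity
  induction hn : b.length using Nat.strong_induction_on generalizing b with
  | _ n ih =>
  subst hn
  match b, ih with
  | [], _ => simp [majorant]
  | [x], _ =>
    have h := coeff_majorant_pow (f / δ) 1 0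
    simp only [pow_one] at h
    simp [taylor_singleton, h, apply_ite norm]
  | x :: y :: t, ih =>
    set b := x :: y :: t with hbdef
    have hb : 2 ≤ b.length := by simp [hbdef]
    have hconv : ∑ c : ι × ι, ‖conv (taylor lam F c.1) (taylor lam F c.2) b‖ ≤
        PowerSeries.coeff b.length (majorant (f / δ) * majorant (f / δ)) := by
      refine sum_norm_conv_le _ _ _ _ _ fun i hi => ?_
      have h0 : PowerSeries.coeff 0 (majorant (f / δ)) = 0 := by simp [majorant]
      rcases Nat.eq_zero_or_pos i with rfl | hi0
      · simp [h0]
      rcases hi.eq_or_lt with rfl | hlt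
      · simp [h0]
      refine mul_le_mul ?_ ?_ (Finset.sum_nonneg fun _ _ => norm_nonneg _) ?_
      · exact ih i hlt _ (by simp [hi])
      · exact ih _ (by lia) _ (by simp)
      · simpa using coeff_majorant_pow_nonneg hr 1 i
    -- The majorant satisfies with equality the recursive inequality for the column sums.
    have hmaj : PowerSeries.coeff b.length (majorant (f / δ)) =
        f / δ * PowerSeries.coeff b.length (majorant (f / δ) * majorant (f / δ)) := by
      conv_lhs => rw [majorant_eq, map_add, PowerSeries.coeff_C_mul, PowerSeries.coeff_X,
        if_neg (by lia), zero_add, pow_two]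
    calc ∑ a, ‖taylor lam F a b‖
        ≤ ∑ a, (∑ c : ι × ι, ‖F a c‖ * ‖conv (taylor lam F c.1) (taylor lam F c.2) b‖) / δ := by
          refine Finset.sum_le_sum fun a _ => ?_
          rw [taylor_of_two_le lam F a hb, norm_div]
          refine div_le_div₀ (Finset.sum_nonneg fun _ _ => by positivity) ?_ hδ (hlam a b hb)
          refine (norm_sum_le _ _).trans_eq ?_
          simp only [norm_mul]
      _ = (∑ c : ι × ι, (∑ a, ‖F a c‖) * ‖conv (taylor lam F c.1) (taylor lam F c.2) b‖) / δ := by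
          rw [← Finset.sum_div, Finset.sum_comm]
          simp only [Finset.sum_mul]
      _ ≤ (∑ c : ι × ι, f * ‖conv (taylor lam F c.1) (taylor lam F c.2) b‖) / δ := by
          gcongr with c
          exact hF c
      _ ≤ _ := by
          rw [← Finset.mul_sum, hmaj, div_mul_eq_mul_div]
          gcongr

theorem sum_norm_tensorTaylor_le (hf : 0 ≤ f) (hδ : 0 < δ) (hF : ∀ c, ∑ a, ‖F a c‖ ≤ f)
    (hlam : ∀ (a : ι) (b : List ι), 2 ≤ b.length → δ ≤ ‖(b.map lam).sum - lam a‖)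
    (k : ℕ) (b : List ι) :
    ∑ a : Fin k → ι, ‖tensorTaylor lam F (List.ofFn a) b‖ ≤
      PowerSeries.coeff b.length (majorant (f / δ) ^ k) := by
  have hr : 0 ≤ f / δ := by positivity
  induction k generalizing b with
  | zero => cases b <;> simp [tensorTaylor_nil, PowerSeries.coeff_one]
  | succ k ih =>
    rw [sum_ofFn_succ fun l => ‖tensorTaylor lam F l b‖, pow_succ']
    refine sum_norm_conv_le (taylor lam F) (fun a => tensorTaylor lam F (List.ofFn a)) _ _ _
      fun i hi => ?_
    refine mul_le_mul ?_ ?_ (Finset.sum_nonneg fun _ _ => norm_nonneg _) ?_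
    · simpa [hi] using sum_norm_taylor_le hf hδ hF hlam (b.take i)
    · simpa using ih (b.drop i)
    · simpa using coeff_majorant_pow_nonneg hr 1 i

end Majorant

/-! ### Kronecker powers, sums and shifts under a change of basis. -/

section KroneckerPowers

variable {R : Type*} [CommRing R] {n : ℕ}

/-- Splitting off the first letter of a tuple. -/
def unconsEquiv (n k : ℕ) : (Fin (k + 1) → Fin n) ≃ Fin n × (Fin k → Fin n) :=
  (Fin.consEquiv fun _ => Fin n).symm

/-- Splitting off the first two letters of a tuple. -/
def unconsTwoEquiv (n k : ℕ) : (Fin (k + 2) → Fin n) ≃ (Fin n × Fin n) × (Fin k → Fin n) :=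
  (unconsEquiv n (k + 1)).trans
    (((Equiv.refl (Fin n)).prodCongr (unconsEquiv n k)).trans (Equiv.prodAssoc _ _ _).symm)

theorem kronPow_one (k : ℕ) : kronPow (1 : Matrix (Fin n) (Fin n) R) k = 1 := by
  ext a b
  simp only [kronPow, Matrix.of_apply, Matrix.one_apply, Finset.prod_ite_zero,
    Finset.prod_const_one, Finset.mem_univ, true_imp_iff, funext_iff]

theorem kronPow_succ (M : Matrix (Fin n) (Fin n) R) (k : ℕ) :
    kronPow M (k + 1) = (M ⊗ₖ kronPow M k).submatrix (unconsEquiv n k) (unconsEquiv n k) := by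
  ext a b
  simp [kronPow, Fin.prod_univ_succ, unconsEquiv, Fin.consEquiv, Fin.tail]

theorem kronPow_succ_succ (M : Matrix (Fin n) (Fin n) R) (k : ℕ) :
    kronPow M (k + 2) =
      ((M ⊗ₖ M) ⊗ₖ kronPow M k).submatrix (unconsTwoEquiv n k) (unconsTwoEquiv n k) := by
  ext a b
  simp [kronPow, Fin.prod_univ_succ, unconsTwoEquiv, unconsEquiv, Fin.consEquiv, Fin.tail,
    mul_assoc]

theorem kronSum_succ (M : Matrix (Fin n) (Fin n) R) (k : ℕ) :
    kronSum M (k + 1) =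
      (M ⊗ₖ 1 + 1 ⊗ₖ kronSum M k).submatrix (unconsEquiv n k) (unconsEquiv n k) := by
  ext a b
  rw [← kronPow_one]
  simp [kronSum, kronPow, Fin.sum_univ_succ, Finset.prod_filter, Fin.prod_univ_succ, unconsEquiv,
    Fin.consEquiv, Fin.tail, Finset.mul_sum, mul_assoc]
  rfl

theorem kronShift_zero (F : Matrix (Fin n) (Fin n × Fin n) R) : kronShift F 0 = 0 := by
  ext a b
  simp [kronShift]

theorem kronShift_succ (F : Matrix (Fin n) (Fin n × Fin n) R) (k : ℕ) :
    kronShift F (k + 1) =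
      (F ⊗ₖ 1).submatrix (unconsEquiv n k) (unconsTwoEquiv n k) +
        (1 ⊗ₖ kronShift F k).submatrix (unconsEquiv n k) (unconsEquiv n (k + 1)) := by
  ext a b
  rw [← kronPow_one]
  simp [kronShift, kronPow, Fin.sum_univ_succ, Finset.prod_filter, Fin.prod_univ_succ,
    unconsTwoEquiv, unconsEquiv, Fin.consEquiv, Fin.tail, Finset.mul_sum, mul_assoc]
  rfl

theorem kronPow_mul (M P : Matrix (Fin n) (Fin n) R) (k : ℕ) :
    kronPow (M * P) k = kronPow M k * kronPow P k := by
  induction k with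
  | zero => ext a b; simp [kronPow, Matrix.mul_apply]
  | succ k ih =>
    rw [kronPow_succ, kronPow_succ, kronPow_succ, Matrix.submatrix_mul_equiv,
      ← Matrix.mul_kronecker_mul, ih]

theorem kronSum_mul_kronPow {M P Q : Matrix (Fin n) (Fin n) R} (h : M * P = P * Q) (k : ℕ) :
    kronSum M k * kronPow P k = kronPow P k * kronSum Q k := by
  induction k with
  | zero => ext a b; simp [kronSum, Matrix.mul_apply]
  | succ k ih =>
    rw [kronSum_succ, kronSum_succ, kronPow_succ, Matrix.submatrix_mul_equiv,
      Matrix.submatrix_mul_equiv, Matrix.add_mul, Matrix.mul_add]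
    simp only [← Matrix.mul_kronecker_mul, ih, h, Matrix.one_mul, Matrix.mul_one]

theorem kronShift_mul_kronPow {F G : Matrix (Fin n) (Fin n × Fin n) R}
    {P : Matrix (Fin n) (Fin n) R} (h : F * (P ⊗ₖ P) = P * G) (k : ℕ) :
    kronShift F k * kronPow P (k + 1) = kronPow P k * kronShift G k := by
  induction k with
  | zero => simp [kronShift_zero]
  | succ k ih =>
    rw [kronShift_succ, kronShift_succ, Matrix.add_mul, Matrix.mul_add]
    congr 1
    · rw [kronPow_succ_succ, kronPow_succ, Matrix.submatrix_mul_equiv, Matrix.submatrix_mul_equiv,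
        ← Matrix.mul_kronecker_mul, ← Matrix.mul_kronecker_mul, h, Matrix.one_mul, Matrix.mul_one]
    · rw [kronPow_succ P (k + 1), Matrix.submatrix_mul_equiv, ← Matrix.mul_kronecker_mul, ih,
        kronPow_succ P k, Matrix.submatrix_mul_equiv, ← Matrix.mul_kronecker_mul, Matrix.one_mul,
        Matrix.mul_one]

theorem kronSum_diagonal (lam : Fin n → R) (k : ℕ) :
    kronSum (Matrix.diagonal lam) k = Matrix.diagonal fun a => ((List.ofFn a).map lam).sum := by
  induction k with
  | zero => ext a b; simp [kronSum, Matrix.diagonal_apply]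
  | succ k ih =>
    rw [kronSum_succ, ih, ← Matrix.diagonal_one, ← Matrix.diagonal_one,
      Matrix.diagonal_kronecker_diagonal, Matrix.diagonal_kronecker_diagonal, Matrix.diagonal_add,
      Matrix.submatrix_diagonal_equiv]
    congr 1
    ext a
    simp [unconsEquiv, Fin.consEquiv, List.ofFn_succ]
    rfl

/-- Identifies the superdiagonal Carleman blocks with the operator on words. -/
theorem sum_kronShift_mul (F : Matrix (Fin n) (Fin n × Fin n) ℂ) (G : List (Fin n) → ℂ) (k : ℕ)
    (a : Fin k → Fin n) :
    ∑ c, kronShift F k a c * G (List.ofFn c) = shiftAct F G (List.ofFn a) := by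
  induction k generalizing G with
  | zero => simp [kronShift_zero, shiftAct]
  | succ k ih =>
    simp only [kronShift_succ, Matrix.add_apply, add_mul, Finset.sum_add_distrib]
    rw [List.ofFn_succ, shiftAct, ← ih]
    congr 1
    · rw [← (unconsTwoEquiv n k).symm.sum_comp, Fintype.sum_prod_type]
      refine Finset.sum_congr rfl fun c _ => ?_
      simp [Matrix.one_apply, unconsTwoEquiv, unconsEquiv, Fin.consEquiv,
        List.ofFn_succ]
      exact Or.inl rfl
    · rw [← (unconsEquiv n (k + 1)).symm.sum_comp, Fintype.sum_prod_type]
      simp [Matrix.one_apply, unconsEquiv, Fin.consEquiv, List.ofFn_succ]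
      rfl

end KroneckerPowers


/-! ### The induced norm as the largest column sum. -/

section OneNorm

variable {ι κ μ : Type*} [Fintype ι] [Fintype κ] [DecidableEq κ] [Fintype μ] [DecidableEq μ]

theorem oneNorm_nonneg (M : Matrix ι κ ℂ) : 0 ≤ oneNorm M := norm_nonneg _

theorem oneNorm_le {M : Matrix ι κ ℂ} {c : ℝ} (hc : 0 ≤ c) (h : ∀ j, ∑ i, ‖M i j‖ ≤ c) :
    oneNorm M ≤ c := by
  refine ContinuousLinearMap.opNorm_le_bound _ hc fun x => ?_
  rw [PiLp.norm_eq_of_L1, PiLp.norm_eq_of_L1]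
  calc ∑ i, ‖(M.mulVec x.ofLp) i‖ ≤ ∑ i, ∑ j, ‖M i j‖ * ‖x j‖ := by
        refine Finset.sum_le_sum fun i _ => (norm_sum_le _ _).trans_eq ?_
        simp only [norm_mul]
    _ = ∑ j, (∑ i, ‖M i j‖) * ‖x j‖ := by
        rw [Finset.sum_comm]
        simp only [Finset.sum_mul]
    _ ≤ ∑ j, c * ‖x j‖ := by
        gcongr with j
        exact h j
    _ = c * ∑ j, ‖x j‖ := by rw [Finset.mul_sum]

theorem sum_norm_le_oneNorm (M : Matrix ι κ ℂ) (j : κ) : ∑ i, ‖M i j‖ ≤ oneNorm M := by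
  have h := (Matrix.toLpLin 1 1 M).toContinuousLinearMap.le_opNorm (PiLp.single 1 j (1 : ℂ))
  rw [PiLp.norm_single, norm_one, mul_one, PiLp.norm_eq_of_L1] at h
  simpa [oneNorm, Matrix.toLpLin_apply] using h

theorem oneNorm_mul_le (A : Matrix ι κ ℂ) (B : Matrix κ μ ℂ) :
    oneNorm (A * B) ≤ oneNorm A * oneNorm B := by
  refine oneNorm_le (mul_nonneg (oneNorm_nonneg _) (oneNorm_nonneg _)) fun j => ?_
  calc ∑ i, ‖(A * B) i j‖ ≤ ∑ i, ∑ l, ‖A i l‖ * ‖B l j‖ := by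
        refine Finset.sum_le_sum fun i _ => (norm_sum_le _ _).trans_eq ?_
        simp only [norm_mul]
    _ = ∑ l, (∑ i, ‖A i l‖) * ‖B l j‖ := by
        rw [Finset.sum_comm]
        simp only [Finset.sum_mul]
    _ ≤ ∑ l, oneNorm A * ‖B l j‖ := by
        gcongr with l
        exact sum_norm_le_oneNorm A l
    _ = oneNorm A * ∑ l, ‖B l j‖ := by rw [Finset.mul_sum]
    _ ≤ oneNorm A * oneNorm B :=
        mul_le_mul_of_nonneg_left (sum_norm_le_oneNorm B j) (oneNorm_nonneg _)

theorem oneNorm_kronecker_self_le {n : ℕ} {P : Matrix (Fin n) (Fin n) ℂ} (h : oneNorm P ≤ 1) :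
    oneNorm (P ⊗ₖ P) ≤ 1 := by
  refine oneNorm_le zero_le_one fun j => ?_
  have hj : ∀ j, ∑ i, ‖P i j‖ ≤ 1 := fun j => (sum_norm_le_oneNorm P j).trans h
  simp only [Matrix.kroneckerMap_apply, norm_mul, Fintype.sum_prod_type]
  rw [← Finset.sum_mul_sum]
  exact mul_le_one₀ (hj _) (Finset.sum_nonneg fun _ _ => norm_nonneg _) (hj _)

theorem oneNorm_kronPow_le {n : ℕ} {P : Matrix (Fin n) (Fin n) ℂ} (h : oneNorm P ≤ 1) (k : ℕ) :
    oneNorm (kronPow P k) ≤ 1 := by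
  refine oneNorm_le zero_le_one fun b => ?_
  simp only [kronPow, Matrix.of_apply, norm_prod]
  rw [← Fintype.prod_sum fun l i => ‖P i (b l)‖]
  exact Finset.prod_le_one (fun _ _ => Finset.sum_nonneg fun _ _ => norm_nonneg _)
    fun l _ => (sum_norm_le_oneNorm P (b l)).trans h

end OneNorm

/-! ### Normalized eigenvectors and the condition number. -/

section NormalizeColumns

variable {n : ℕ} {W : Matrix (Fin n) (Fin n) ℂ}

theorem sum_norm_col_pos (hW : IsUnit W.det) (j : Fin n) : 0 < ∑ l, ‖W l j‖ := by
  refine lt_of_le_of_ne (Finset.sum_nonneg fun _ _ => norm_nonneg _) fun h => ?_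
  have h0 := (Finset.sum_eq_zero_iff_of_nonneg fun _ _ => norm_nonneg _).1 h.symm
  exact hW.ne_zero (Matrix.det_eq_zero_of_column_eq_zero j fun i => by
    simpa using h0 i (Finset.mem_univ i))

theorem normalizeColumns_eq (W : Matrix (Fin n) (Fin n) ℂ) :
    normalizeColumns W =
      W * Matrix.diagonal fun j => (((∑ l, ‖W l j‖ : ℝ) : ℂ))⁻¹ := by
  ext i j
  rw [Matrix.mul_diagonal]
  rfl

theorem inv_normalizeColumns_mul (hW : IsUnit W.det) :
    (Matrix.diagonal (fun j => ((∑ l, ‖W l j‖ : ℝ) : ℂ)) * W⁻¹) * normalizeColumns W = 1 := by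
  have h : ∀ j, ((∑ l, ‖W l j‖ : ℝ) : ℂ) ≠ 0 := fun j =>
    Complex.ofReal_ne_zero.2 (sum_norm_col_pos hW j).ne'
  rw [normalizeColumns_eq, Matrix.mul_assoc, Matrix.nonsing_inv_mul_cancel_left _ _ hW,
    Matrix.diagonal_mul_diagonal, ← Matrix.diagonal_one]
  congr 1
  ext j
  exact mul_inv_cancel₀ (h j)

theorem isUnit_det_normalizeColumns (hW : IsUnit W.det) : IsUnit (normalizeColumns W).det :=
  Matrix.isUnit_det_of_left_inverse (inv_normalizeColumns_mul hW)

theorem mul_normalizeColumns (hW : IsUnit W.det) (lam : Fin n → ℂ) :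
    W * Matrix.diagonal lam * W⁻¹ * normalizeColumns W =
      normalizeColumns W * Matrix.diagonal lam := by
  rw [normalizeColumns_eq, Matrix.mul_assoc, Matrix.nonsing_inv_mul_cancel_left _ _ hW,
    Matrix.mul_assoc, Matrix.mul_assoc, Matrix.diagonal_mul_diagonal,
    Matrix.diagonal_mul_diagonal]
  simp only [mul_comm]

theorem oneNorm_normalizeColumns_le (hW : IsUnit W.det) : oneNorm (normalizeColumns W) ≤ 1 := by
  refine oneNorm_le zero_le_one fun j => ?_
  have h := sum_norm_col_pos hW j
  simp only [normalizeColumns, Matrix.of_apply, norm_div, Complex.norm_real, Real.norm_eq_abs,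
    abs_of_pos h]
  rw [← Finset.sum_div, div_self h.ne']

/-- The inverse is `diag(column norms) * W⁻¹`, and every column norm is at most `‖W‖₁`. -/
theorem oneNorm_inv_normalizeColumns_le (hW : IsUnit W.det) :
    oneNorm (normalizeColumns W)⁻¹ ≤ cond W := by
  rw [Matrix.inv_eq_left_inv (inv_normalizeColumns_mul hW)]
  refine (oneNorm_mul_le _ _).trans (mul_le_mul_of_nonneg_right ?_ (oneNorm_nonneg _))
  refine oneNorm_le (oneNorm_nonneg _) fun j => ?_
  rw [Finset.sum_eq_single j (fun i _ hi => by simp [Matrix.diagonal_apply_ne _ hi]) (by simp),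
    Matrix.diagonal_apply_eq, Complex.norm_real, Real.norm_eq_abs,
    abs_of_pos (sum_norm_col_pos hW j)]
  exact sum_norm_le_oneNorm W j

theorem oneNorm_transformed_le (hW : IsUnit W.det) (F : Matrix (Fin n) (Fin n × Fin n) ℂ) :
    oneNorm ((normalizeColumns W)⁻¹ * F * (normalizeColumns W ⊗ₖ normalizeColumns W)) ≤
      cond W * oneNorm F := by
  have h1 := oneNorm_kronecker_self_le (oneNorm_normalizeColumns_le hW)
  calc _ ≤ oneNorm ((normalizeColumns W)⁻¹ * F) *
        oneNorm (normalizeColumns W ⊗ₖ normalizeColumns W) := oneNorm_mul_le _ _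
    _ ≤ oneNorm ((normalizeColumns W)⁻¹ * F) := mul_le_of_le_one_right (oneNorm_nonneg _) h1
    _ ≤ oneNorm (normalizeColumns W)⁻¹ * oneNorm F := oneNorm_mul_le _ _
    _ ≤ cond W * oneNorm F :=
      mul_le_mul_of_nonneg_right (oneNorm_inv_normalizeColumns_le hW) (oneNorm_nonneg _)

end NormalizeColumns

/-! ### Block calculus for the Carleman matrix. -/

section Blocks

variable {R : Type*} [CommRing R] {n N : ℕ}

theorem ext_block {R : Type*} {n N : ℕ} {A B : Matrix (Index n N) (Index n N) R}
    (h : ∀ k j, block A k j = block B k j) : A = B := by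
  ext ⟨k, a⟩ ⟨j, b⟩
  exact congr_fun (congr_fun (h k j) a) b

theorem block_mul (A B : Matrix (Index n N) (Index n N) R) (k j : Fin N) :
    block (A * B) k j = ∑ i, block A k i * block B i j := by
  ext a b
  simp [block, Matrix.mul_apply, Matrix.sum_apply, Fintype.sum_sigma]

theorem block_blockDiagonal'_mul
    (d : ∀ k : Fin N, Matrix (Fin (k.val + 1) → Fin n) (Fin (k.val + 1) → Fin n) R)
    (B : Matrix (Index n N) (Index n N) R) (k j : Fin N) :
    block (Matrix.blockDiagonal' d * B) k j = d k * block B k j := by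
  rw [block_mul, Finset.sum_eq_single k]
  · congr 1
    ext a b
    exact Matrix.blockDiagonal'_apply_eq d k a b
  · intro i _ hi
    have : block (Matrix.blockDiagonal' d) k i = 0 := by
      ext a b
      exact Matrix.blockDiagonal'_apply_ne d a b hi.symm
    rw [this, Matrix.zero_mul]
  · simp

theorem block_mul_blockDiagonal'
    (d : ∀ k : Fin N, Matrix (Fin (k.val + 1) → Fin n) (Fin (k.val + 1) → Fin n) R)
    (B : Matrix (Index n N) (Index n N) R) (k j : Fin N) :
    block (B * Matrix.blockDiagonal' d) k j = block B k j * d j := by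
  rw [block_mul, Finset.sum_eq_single j]
  · congr 1
    ext a b
    exact Matrix.blockDiagonal'_apply_eq d j a b
  · intro i _ hi
    have : block (Matrix.blockDiagonal' d) i j = 0 := by
      ext a b
      exact Matrix.blockDiagonal'_apply_ne d a b hi
    rw [this, Matrix.mul_zero]
  · simp

variable (F₁ : Matrix (Fin n) (Fin n) R) (F₂ : Matrix (Fin n) (Fin n × Fin n) R)

theorem block_carleman_self (k : Fin N) :
    block (carleman F₁ F₂ N) k k = kronSum F₁ (k.val + 1) := by
  ext a b
  simp [block, carleman]

theorem block_carleman_succ (k : Fin N) (h : k.val + 1 < N) :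
    block (carleman F₁ F₂ N) k ⟨k.val + 1, h⟩ = kronShift F₂ (k.val + 1) := by
  ext a b
  simp [block, carleman]

theorem block_carleman_of_ne (k j : Fin N) (h : j.val ≠ k.val) (h' : j.val ≠ k.val + 1) :
    block (carleman F₁ F₂ N) k j = 0 := by
  ext a b
  simp [block, carleman, h.symm, h'.symm]

theorem block_carleman_mul (B : Matrix (Index n N) (Index n N) R) (k j : Fin N) :
    block (carleman F₁ F₂ N * B) k j = kronSum F₁ (k.val + 1) * block B k j +
      if h : k.val + 1 < N then
        kronShift F₂ (k.val + 1) * block B ⟨k.val + 1, h⟩ j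
      else 0 := by
  rw [block_mul, ← Finset.add_sum_erase _ _ (Finset.mem_univ k), block_carleman_self]
  congr 1
  split_ifs with h
  · rw [Finset.sum_eq_single ⟨k.val + 1, h⟩, block_carleman_succ]
    · intro i hi hi'
      rw [block_carleman_of_ne, Matrix.zero_mul]
      · exact fun e => (Finset.mem_erase.1 hi).1 (Fin.ext e)
      · exact fun e => hi' (Fin.ext e)
    · intro hi
      simp [Fin.ext_iff] at hi
  · refine Finset.sum_eq_zero fun i hi => ?_
    rw [block_carleman_of_ne, Matrix.zero_mul]
    · exact fun e => (Finset.mem_erase.1 hi).1 (Fin.ext e)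
    · have := i.2
      lia

theorem carleman_mul_blockPow {F₁ G₁ P : Matrix (Fin n) (Fin n) R}
    {F₂ G₂ : Matrix (Fin n) (Fin n × Fin n) R} (h₁ : F₁ * P = P * G₁)
    (h₂ : F₂ * (P ⊗ₖ P) = P * G₂) :
    carleman F₁ F₂ N * blockPow P N = blockPow P N * carleman G₁ G₂ N := by
  refine ext_block fun k j => ?_
  rw [blockPow, block_mul_blockDiagonal', block_blockDiagonal'_mul]
  by_cases h : j.val = k.val
  · obtain rfl := Fin.ext h
    rw [block_carleman_self, block_carleman_self, kronSum_mul_kronPow h₁]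
  by_cases h' : j.val = k.val + 1
  · obtain ⟨j, hj⟩ := j
    obtain rfl : j = k.val + 1 := h'
    rw [block_carleman_succ, block_carleman_succ, kronShift_mul_kronPow h₂]
  · rw [block_carleman_of_ne _ _ _ _ h h', block_carleman_of_ne _ _ _ _ h h', Matrix.zero_mul,
      Matrix.mul_zero]

theorem isUnit_det_blockPow {P : Matrix (Fin n) (Fin n) R} (hP : IsUnit P.det) :
    IsUnit (blockPow P N).det := by
  refine Matrix.isUnit_det_of_left_inverse (B := blockPow P⁻¹ N) ?_
  rw [blockPow, blockPow, ← Matrix.blockDiagonal'_mul]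
  simp only [← kronPow_mul, Matrix.nonsing_inv_mul _ hP, kronPow_one]
  exact Matrix.blockDiagonal'_one

theorem det_eq_one_of_block {V : Matrix (Index n N) (Index n N) R}
    (hlow : ∀ k j : Fin N, j < k → block V k j = 0) (hdiag : ∀ k : Fin N, block V k k = 1) :
    V.det = 1 := by
  have hV : V.BlockTriangular Sigma.fst := by
    rintro ⟨k, a⟩ ⟨j, b⟩ h
    exact congr_fun (congr_fun (hlow k j h) a) b
  rw [hV.det_fintype]
  refine Finset.prod_eq_one fun k _ => ?_
  have : V.toSquareBlock Sigma.fst k = 1 := by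
    ext ⟨⟨i, a⟩, hi⟩ ⟨⟨j, b⟩, hj⟩
    obtain rfl : i = k := hi
    obtain rfl : j = i := hj
    have h := congr_fun (congr_fun (hdiag j) a) b
    simpa [Matrix.toSquareBlock_def, block, Matrix.one_apply] using h
  rw [this, Matrix.det_one]

theorem eigenvalueMatrix_isDiag (lam : Fin n → R) : (eigenvalueMatrix lam N).IsDiag := by
  simp only [eigenvalueMatrix, kronSum_diagonal, Matrix.blockDiagonal'_diagonal]
  exact Matrix.isDiag_diagonal _

end Blocks

/-! ### Eigenvectors for a diagonal linear part. -/

section Eigenvectors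

variable {n : ℕ} (lam : Fin n → ℂ) (F : Matrix (Fin n) (Fin n × Fin n) ℂ) (N : ℕ)

/-- The eigenvector matrix of the Carleman matrix with diagonal linear part. -/
noncomputable def eigenvectors : Matrix (Index n N) (Index n N) ℂ :=
  Matrix.of fun p q => tensorTaylor lam F (List.ofFn p.2) (List.ofFn q.2)

variable {N}

theorem block_eigenvectors_of_lt {k j : Fin N} (h : j < k) :
    block (eigenvectors lam F N) k j = 0 := by
  ext a b
  exact tensorTaylor_of_length_lt lam F (by simpa using h)

theorem block_eigenvectors_self (k : Fin N) : block (eigenvectors lam F N) k k = 1 := by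
  ext a b
  rw [block, eigenvectors, Matrix.of_apply, Matrix.of_apply,
    tensorTaylor_of_length_eq lam F (by simp), Matrix.one_apply]
  simp only [List.ofFn_injective.eq_iff]

theorem carleman_mul_eigenvectors
    (hlam : ∀ (a : Fin n) (b : List (Fin n)), 2 ≤ b.length → (b.map lam).sum - lam a ≠ 0) :
    carleman (Matrix.diagonal lam) F N * eigenvectors lam F N =
      eigenvectors lam F N * eigenvalueMatrix lam N := by
  refine ext_block fun k j => ?_
  rw [eigenvalueMatrix, block_mul_blockDiagonal', block_carleman_mul]
  ext a b
  have key := sum_mul_tensorTaylor lam F hlam (List.ofFn a) (List.ofFn b)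
  rw [← sum_kronShift_mul F (fun t => tensorTaylor lam F t (List.ofFn b))] at key
  rw [Matrix.add_apply, kronSum_diagonal, kronSum_diagonal, Matrix.diagonal_mul,
    Matrix.mul_diagonal, mul_comm]
  simp only [block, eigenvectors, Matrix.of_apply]
  rw [mul_comm _ ((List.map lam (List.ofFn b)).sum), key, mul_comm]
  congr 1
  split_ifs with h
  · simp [Matrix.mul_apply]
  -- Truncation is harmless: in the last block row the missing shift would meet row words of length
  -- `N + 1`, longer than every column word.
  · refine (Finset.sum_eq_zero fun c _ => ?_).symm
    rw [tensorTaylor_of_length_lt, mul_zero]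
    have := j.2
    simp only [List.length_ofFn]
    lia

/-- Letter multiplicities turn a word into the exponents `m_j` of the resonance conditions. -/
theorem sum_map_eq_sum_count (b : List (Fin n)) :
    (b.map lam).sum = ∑ j, (b.count j : ℂ) * lam j := by
  induction b with
  | nil => simp
  | cons x b ih =>
    simp [List.count_cons, add_mul, Finset.sum_add_distrib, ih, add_comm]

theorem sum_count_eq_length (b : List (Fin n)) : ∑ j, b.count j = b.length := by
  induction b with
  | nil => simp
  | cons x b ih => simp [List.count_cons, Finset.sum_add_distrib, ih]

variable {lam}

theorem NoResonance.sum_sub_ne_zero (hres : NoResonance lam) (a : Fin n) (b : List (Fin n))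
    (hb : 2 ≤ b.length) : (b.map lam).sum - lam a ≠ 0 := by
  rw [sum_map_eq_sum_count]
  exact sub_ne_zero.2 (hres a _ (by rwa [sum_count_eq_length])).symm

theorem resonanceParam_le (a : Fin n) (b : List (Fin n)) (hb : 2 ≤ b.length) :
    resonanceParam lam ≤ ‖(b.map lam).sum - lam a‖ := by
  rw [sum_map_eq_sum_count, norm_sub_rev]
  refine (ciInf_le ⟨0, ?_⟩ a).trans
    (ciInf_le (⟨0, ?_⟩ : BddBelow (Set.range fun m : {m : Fin n → ℕ // 2 ≤ ∑ j, m j} =>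
      ‖lam a - ∑ j, (m.1 j : ℂ) * lam j‖)) ⟨fun j => b.count j, by rwa [sum_count_eq_length]⟩)
  · rintro _ ⟨k, rfl⟩
    exact Real.iInf_nonneg fun _ => norm_nonneg _
  · rintro _ ⟨m, rfl⟩
    exact norm_nonneg _

theorem oneNorm_block_eigenvectors_le {f : ℝ} (hΔ : 0 < resonanceParam lam) (hf : oneNorm F ≤ f)
    {k j : Fin N} (hkj : k ≤ j) :
    oneNorm (block (eigenvectors lam F N) k j) ≤
      (f / resonanceParam lam) ^ (j.val - k.val) * ballot (k.val + 1) (j.val - k.val) := by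
  have hf0 : 0 ≤ f := (oneNorm_nonneg F).trans hf
  refine oneNorm_le (by positivity) fun b => ?_
  have h := sum_norm_tensorTaylor_le hf0 hΔ (fun c => (sum_norm_le_oneNorm F c).trans hf)
    resonanceParam_le (k.val + 1) (List.ofFn b)
  rw [List.length_ofFn, coeff_majorant_pow_of_le _ (by simpa using hkj),
    Nat.add_sub_add_right] at h
  exact h

end Eigenvectors

/-! ### From ballot numbers to the three estimates. -/

section Bounds

/-- Combines `p.choose m ≤ p ^ m / m!` with `m ^ m / m! ≤ e ^ m`, one term of the exponential
series. -/
theorem choose_le_exp_mul_div_pow (p m : ℕ) (hm : 0 < m) :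
    (p.choose m : ℝ) ≤ (Real.exp 1 * (p / m)) ^ m := by
  have hm' : (0 : ℝ) < m := by exact_mod_cast hm
  have h1 : (p.choose m : ℝ) ≤ (p : ℝ) ^ m / m.factorial := Nat.choose_le_pow_div m p
  have h2 := Real.pow_div_factorial_le_exp (x := (m : ℝ)) hm'.le m
  have h3 : Real.exp m = Real.exp 1 ^ m := by rw [← Real.exp_nat_mul, mul_one]
  calc (p.choose m : ℝ) ≤ (p : ℝ) ^ m / m.factorial := h1
    _ = (p / m : ℝ) ^ m * ((m : ℝ) ^ m / m.factorial) := by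
        rw [div_pow]
        field_simp
    _ ≤ (p / m : ℝ) ^ m * Real.exp 1 ^ m := by
        rw [← h3]
        gcongr
    _ = (Real.exp 1 * (p / m)) ^ m := by rw [mul_pow, mul_comm]

/-- Here `k` and `j` are zero-based, so the tensor orders are `k + 1` and `j + 1`. The last estimate
uses the ballot number directly, since the binomial is too large for it. -/
theorem bounds_of_le_ballot {k j : ℕ} {x c : ℝ} (hx : 0 ≤ x)
    (h : k ≤ j → c ≤ x ^ (j - k) * ballot (k + 1) (j - k)) :
    (k ≤ j → c ≤ x ^ (j - k) * ((2 * (j + 1) - (k + 1)).choose (j - k) : ℝ)) ∧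
    (k < j → c ≤ (Real.exp 1 * ((2 * (j + 1) - (k + 1) : ℝ) / (j - k : ℝ)) * x) ^ (j - k)) ∧
    (k ≤ j → k + 1 ≤ 5 → c ≤ (2 * Real.exp 1 * x) ^ (j - k)) := by
  have hchoose : k ≤ j → c ≤ x ^ (j - k) * ((2 * (j + 1) - (k + 1)).choose (j - k) : ℝ) := by
    intro hkj
    refine (h hkj).trans ?_
    gcongr
    rw [show 2 * (j + 1) - (k + 1) = 2 * (j - k) + (k + 1) by lia]
    exact ballot_le_choose _ _
  refine ⟨hchoose, fun hkj => ?_, fun hkj hk => ?_⟩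
  · refine (hchoose hkj.le).trans ?_
    have h1 := choose_le_exp_mul_div_pow (2 * (j + 1) - (k + 1)) (j - k) (by lia)
    rw [Nat.cast_sub (by lia), Nat.cast_sub hkj.le] at h1
    push_cast at h1
    rw [mul_pow _ x, mul_comm]
    gcongr
  · refine (h hkj).trans ?_
    have h1 : ballot (k + 1) (j - k) ≤ 5 ^ (j - k) :=
      (ballot_mono_left (j - k) hk).trans (ballot_five_le _)
    have h2 : (5 : ℝ) ≤ 2 * Real.exp 1 := by linarith [Real.exp_one_gt_d9]
    rw [mul_pow _ x, mul_comm]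
    gcongr
    calc (ballot (k + 1) (j - k) : ℝ) ≤ 5 ^ (j - k) := by exact_mod_cast h1
      _ ≤ (2 * Real.exp 1) ^ (j - k) := by gcongr

end Bounds

end Carleman

theorem mainTheorem2 (n N : ℕ)
    (F₁ : Matrix (Fin n) (Fin n) ℂ) (F₂ : Matrix (Fin n) (Fin n × Fin n) ℂ)
    (W : Matrix (Fin n) (Fin n) ℂ) (lam : Fin n → ℂ)
    (hW : IsUnit W.det) (hF₁ : F₁ = W * Matrix.diagonal lam * W⁻¹)
    (hres : Carleman.NoResonance lam) :
    (Carleman.eigenvalueMatrix lam N).IsDiag ∧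
    ∃ V V₀ : Matrix (Carleman.Index n N) (Carleman.Index n N) ℂ,
      -- `V` diagonalizes the Carleman matrix
      IsUnit V.det ∧
      Carleman.carleman F₁ F₂ N * V = V * Carleman.eigenvalueMatrix lam N ∧
      (∀ k j : Fin N, j < k → Carleman.block V k j = 0) ∧
      (∀ k : Fin N, Carleman.block V k k =
        Carleman.kronPow (Carleman.normalizeColumns W) (k.val + 1)) ∧
      -- `V₀` is `V` in the eigenbasis of `F₁`, where the diagonal blocks are identities
      V = Carleman.blockPow (Carleman.normalizeColumns W) N * V₀ ∧
      Carleman.carleman (Matrix.diagonal lam)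
          ((Carleman.normalizeColumns W)⁻¹ * F₂ *
            (Carleman.normalizeColumns W ⊗ₖ Carleman.normalizeColumns W)) N * V₀ =
        V₀ * Carleman.eigenvalueMatrix lam N ∧
      (∀ k j : Fin N, j < k → Carleman.block V₀ k j = 0) ∧
      (∀ k : Fin N, Carleman.block V₀ k k = 1) ∧
      -- the bounds on the blocks, the same for `V` and for `V₀`
      (0 < Carleman.resonanceParam lam → ∀ M : Matrix (Carleman.Index n N) (Carleman.Index n N) ℂ,
        M = V ∨ M = V₀ → ∀ k j : Fin N,
        (k ≤ j → Carleman.oneNorm (Carleman.block M k j) ≤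
          (Carleman.cond W * Carleman.oneNorm F₂ / Carleman.resonanceParam lam) ^
              (j.val - k.val) *
            (Nat.choose (2 * (j.val + 1) - (k.val + 1)) (j.val - k.val) : ℝ)) ∧
        (k < j → Carleman.oneNorm (Carleman.block M k j) ≤
          (Real.exp 1 * ((2 * (j.val + 1) - (k.val + 1) : ℝ) / (j.val - k.val : ℝ)) *
              Carleman.cond W * Carleman.oneNorm F₂ / Carleman.resonanceParam lam) ^
            (j.val - k.val)) ∧
        (k ≤ j → k.val + 1 ≤ 5 → Carleman.oneNorm (Carleman.block M k j) ≤
          (2 * Real.exp 1 * Carleman.cond W * Carleman.oneNorm F₂ /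
            Carleman.resonanceParam lam) ^ (j.val - k.val))) := by
  have hP := Carleman.isUnit_det_normalizeColumns hW
  have hP1 := Carleman.oneNorm_normalizeColumns_le hW
  have hF := Carleman.oneNorm_transformed_le hW F₂
  have h₁ : F₁ * Carleman.normalizeColumns W =
      Carleman.normalizeColumns W * Matrix.diagonal lam := by
    rw [hF₁, Carleman.mul_normalizeColumns hW]
  set P := Carleman.normalizeColumns W
  set G := P⁻¹ * F₂ * (P ⊗ₖ P) with hG
  have h₂ : F₂ * (P ⊗ₖ P) = P * G := by
    rw [hG, Matrix.mul_assoc, Matrix.mul_nonsing_inv_cancel_left _ _ hP]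
  have hlow : ∀ k j : Fin N, j < k → Carleman.block (Carleman.eigenvectors lam G N) k j = 0 :=
    fun k j h => Carleman.block_eigenvectors_of_lt lam G h
  have hdiag := Carleman.block_eigenvectors_self lam G (N := N)
  have hV₀ := Carleman.carleman_mul_eigenvectors (N := N) lam G hres.sum_sub_ne_zero
  have hblock : ∀ k j, Carleman.block (Carleman.blockPow P N * Carleman.eigenvectors lam G N) k j =
      Carleman.kronPow P (k.val + 1) * Carleman.block (Carleman.eigenvectors lam G N) k j :=
    fun k j => Carleman.block_blockDiagonal'_mul _ _ k j
  refine ⟨Carleman.eigenvalueMatrix_isDiag lam,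
    Carleman.blockPow P N * Carleman.eigenvectors lam G N, Carleman.eigenvectors lam G N,
    ?_, ?_, fun k j h => ?_, fun k => ?_, rfl, hV₀, hlow, hdiag, fun hΔ M hM k j => ?_⟩
  · rw [Matrix.det_mul, Carleman.det_eq_one_of_block hlow hdiag, mul_one]
    exact Carleman.isUnit_det_blockPow hP
  · rw [← Matrix.mul_assoc, Carleman.carleman_mul_blockPow h₁ h₂, Matrix.mul_assoc, hV₀,
      Matrix.mul_assoc]
  · rw [hblock, hlow k j h, Matrix.mul_zero]
  · rw [hblock, hdiag, Matrix.mul_one]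
  -- Blocks of `V` are those of `V₀` multiplied on the left by `P^{⊗k}`, of norm at most one, so
  -- bounding `V₀` suffices.
  · have hle : Carleman.oneNorm (Carleman.block M k j) ≤
        Carleman.oneNorm (Carleman.block (Carleman.eigenvectors lam G N) k j) := by
      rcases hM with rfl | rfl
      · rw [hblock]
        exact (Carleman.oneNorm_mul_le _ _).trans (mul_le_of_le_one_left
          (Carleman.oneNorm_nonneg _) (Carleman.oneNorm_kronPow_le hP1 _))
      · exact le_rfl
    have hx : 0 ≤ Carleman.cond W * Carleman.oneNorm F₂ / Carleman.resonanceParam lam :=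
      div_nonneg ((Carleman.oneNorm_nonneg _).trans hF) hΔ.le
    have h := Carleman.bounds_of_le_ballot (k := k.val) (j := j.val) hx fun hkj =>
      hle.trans (Carleman.oneNorm_block_eigenvectors_le G hΔ hF (Fin.le_def.2 hkj))
    simp only [mul_div_assoc, mul_assoc] at h ⊢
    exact h
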